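/- Let $n\ge 1$ and $[n]=\{1,\dots,n\}$. An involution $w$ of $[n]$ (a permutation with $w^2=\mathrm{id}$) is \emph{noncrossing} if there are no $i_1<i_2<j_1<j_2$ with $w(i_1)=j_1$ and $w(i_2)=j_2$. A permutation $w$ of $[n]$ is \emph{prime} if it is not a direct sum $u\oplus v=u(1)\cdots u(a)\,(v(1)+a)\cdots(v(b)+a)$ of permutations $u$ of $[a]$ and $v$ of $[b]$ with $a,b\ge1$. A standard Young tableau $T$ of size $n$ is a \emph{Richardson tableau} if for every entry $j$ of $T$ lying in a row $r\ge 2$, the largest among the entries smaller than $j$ of $T$ in row $r-1$ is greater than every entry smaller than $j$ of $T$ lying in or strictly below row $r$. The \emph{concatenation} $T\circ T'$ of standard tableaux of sizes $a$ and $b$ is obtained by adding $a$ to every entry of $T'$ and then concatenating the corresponding rows of $T$ and $T'$; a standard tableau is \emph{prime} if it is not a concatenation of two standard tableaux of sizes $a,b\ge 1$. Let $\mathrm{NC}(n)$ be the set of noncrossing involutions of $[n]$, let $\mathrm{RT}(n)$ be the set of Richardson tableaux of size $n$, and let $\Phi$ send a permutation to its Robinson--Schensted (row) insertion tableau. Then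 $\Phi$ restricts to a bijection $\mathrm{NC}(n)\to\mathrm{RT}(n)$; an element $w\in\mathrm{NC}(n)$ is prime if and only if $w(1)=n$; and the image under $\Phi$ of the set of prime noncrossing involutions of $[n]$ is exactly the set of prime Richardson tableaux of size $n$. -/

import Mathlib

namespace RichardsonTableau

/-! ### Permutations and noncrossing involutions

`[n] = {1, …, n}` is modelled by `Fin n`; the element `i : Fin n` stands for the number `i + 1`. -/

/-- The one-line notation `w(1) w(2) ⋯ w(n)` of a permutation of `[n]`, with letters in
`{1, …, n}`. -/
def word {n : ℕ} (w : Equiv.Perm (Fin n)) : List ℕ :=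
  List.ofFn fun i => (w i : ℕ) + 1

/-- `w` is the direct sum `u ⊕ v`, the permutation `u(1) ⋯ u(a) (v(1) + a) ⋯ (v(b) + a)`. -/
def IsDirectSum {n a b : ℕ} (w : Equiv.Perm (Fin n)) (u : Equiv.Perm (Fin a))
    (v : Equiv.Perm (Fin b)) : Prop :=
  word w = word u ++ (word v).map (· + a)

/-- A permutation is prime if it is not a direct sum of two smaller (nonempty) permutations. -/
def IsPrimePerm {n : ℕ} (w : Equiv.Perm (Fin n)) : Prop :=
  ¬ ∃ (a b : ℕ) (u : Equiv.Perm (Fin a)) (v : Equiv.Perm (Fin b)),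
    0 < a ∧ 0 < b ∧ IsDirectSum w u v

/-- There are no two arcs `(i₁, j₁)`, `(i₂, j₂)` with `i₁ < i₂ < j₁ < j₂`. -/
def IsNoncrossing {n : ℕ} (w : Equiv.Perm (Fin n)) : Prop :=
  ¬ ∃ i₁ i₂ j₁ j₂ : Fin n, w i₁ = j₁ ∧ w i₂ = j₂ ∧ i₁ < i₂ ∧ i₂ < j₁ ∧ j₁ < j₂

/-- `NC(n)`: the noncrossing involutions of `[n]` (the identity counts as an involution). -/
def NC (n : ℕ) : Set (Equiv.Perm (Fin n)) :=
  {w | Function.Involutive w ∧ IsNoncrossing w}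

/-- The prime noncrossing involutions of `[n]`. -/
def PrimeNC (n : ℕ) : Set (Equiv.Perm (Fin n)) :=
  {w | w ∈ NC n ∧ IsPrimePerm w}

/-! ### Standard tableaux, written as the list of their rows from top to bottom -/

/-- The list of rows of a semistandard Young tableau of shape `μ`. -/
def rowsOf {μ : YoungDiagram} (T : SemistandardYoungTableau μ) : List (List ℕ) :=
  (List.range (μ.colLen 0)).map fun i => (List.range (μ.rowLen i)).map fun j => T i j

/-- `R` is the list of rows of a standard Young tableau of size `n`, that is, of a semistandard
tableau whose entries are `1, …, n`, each occurring once. -/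
def IsStandard (n : ℕ) (R : List (List ℕ)) : Prop :=
  (∃ (μ : YoungDiagram) (T : SemistandardYoungTableau μ), R = rowsOf T) ∧
    R.flatten.Perm (List.range' 1 n)

/-- Row `i` of `R`, rows being counted from `0`; it is empty below the last row. -/
def row (R : List (List ℕ)) (i : ℕ) : List ℕ := R.getD i []

/-- The Richardson condition: for every entry `j` outside the first row, say in row `i + 1`,
the largest entry of `R_{< j}` in row `i` exceeds all entries of `R_{< j}` in or strictly below
row `i + 1`. Here `R_{< j}` consists of the entries of `R` that are smaller than `j`. -/
def RichardsonCondition (R : List (List ℕ)) : Prop :=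
  ∀ i j : ℕ, j ∈ row R (i + 1) →
    ∃ m, IsGreatest {x | x ∈ row R i ∧ x < j} m ∧
      ∀ k, i + 1 ≤ k → ∀ x ∈ row R k, x < j → x < m

/-- `RT(n)`: the Richardson tableaux of size `n`. -/
def RT (n : ℕ) : Set (List (List ℕ)) :=
  {R | IsStandard n R ∧ RichardsonCondition R}

/-- Concatenation of corresponding rows. -/
def appendRows : List (List ℕ) → List (List ℕ) → List (List ℕ)
  | [], S => S
  | r :: R, [] => r :: R
  | r :: R, s :: S => (r ++ s) :: appendRows R S

/-- The concatenation `R ∘ S` of a standard tableau `R` of size `a` with a standard tableau `S`: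
increase every entry of `S` by `a`, then concatenate the corresponding rows. -/
def concat (a : ℕ) (R S : List (List ℕ)) : List (List ℕ) :=
  appendRows R (S.map fun s => s.map (· + a))

/-- A standard tableau is prime if it is not a concatenation of two smaller (nonempty) standard
tableaux. -/
def IsPrimeTableau (R : List (List ℕ)) : Prop :=
  ¬ ∃ (a b : ℕ) (P Q : List (List ℕ)),
    0 < a ∧ 0 < b ∧ IsStandard a P ∧ IsStandard b Q ∧ R = concat a P Q

/-- The prime Richardson tableaux of size `n`. -/
def PrimeRT (n : ℕ) : Set (List (List ℕ)) :=
  {R | R ∈ RT n ∧ IsPrimeTableau R}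

/-! ### The Robinson–Schensted insertion algorithm -/

/-- Insert `x` into a single row: `x` replaces the leftmost entry greater than `x`, which is
returned as the bumped entry; if there is no such entry, `x` is placed at the end of the row. -/
def rowInsert (x : ℕ) : List ℕ → List ℕ × Option ℕ
  | [] => ([x], none)
  | y :: ys => if x < y then (x :: ys, some y) else (y :: (rowInsert x ys).1, (rowInsert x ys).2)

/-- `R ← x`: insert `x` into the first row, then the bumped entry into the next row, and so on,
until nothing is bumped. -/
def insertEntry : List (List ℕ) → ℕ → List (List ℕ)
  | [], x => [[x]]
  | r :: R, x =>
    match rowInsert x r with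
    | (r', none) => r' :: R
    | (r', some y) => r' :: insertEntry R y

/-- The map `Φ` sending a permutation `w` to its insertion tableau
`((∅ ← w(1)) ← w(2)) ← ⋯ ← w(n)`. -/
def Φ {n : ℕ} (w : Equiv.Perm (Fin n)) : List (List ℕ) :=
  (word w).foldl insertEntry []

end RichardsonTableau

/-! Record a tableau by the word whose `x`-th letter is the row of the entry `x`. The Richardson
condition becomes local: a letter `i + 1` may be written exactly when the last earlier letter that
is at least `i` is `i` itself (`isRich_iff`, `richardsonCondition_iff`). Such a word automatically
gives a standard tableau, so `RT n` is the set of rich words of length `n` (`mem_RT_iff`).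

Looking at its last point, a nonempty noncrossing involution is `p ⊕ 1` or `p ⊕ (arc around s)`,
with `p` and `s` again noncrossing; hence the binary codes `NCTree`. Insertion respects this
recursion. For direct sums it concatenates tableaux, hence words (`foldl_insertEntry_append_map`,
`tab_append`). For an arc around `s`, the first letter is larger than all others and stays below the
tableau of `s` as a row of its own; the final letter `1` then pushes the whole first column down by
one row. As the first column holds the first occurrences of the letters, the new word is `arcWord s`
(`foldl_insertEntry_arc`).

Rich words obey the same recursion: a last letter `0` can be removed, and a last letter `e + 1`
closes a unique final block `arcWord s` with `height s = e` (`exists_eq_arcBody_append`,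
`arcBody_append_inj`). So trees are in bijection with both sides, and no general Robinson–Schensted
theory is needed.

For primality, an involution with `w(1) ≠ n` splits after `w(1)`, and its tableau splits with it. If
`w(1) = n`, the word is `0` or a single arc word. An arc word has no proper final segment that is a
lattice word (`eq_nil_of_arcWord_eq_append`), so its tableau is not a concatenation of smaller
standard tableaux. -/

namespace RichardsonTableau

/-! ### Richardson words

A tableau is encoded by the word of the row indices of its entries `1, …, n`. Such words are
written from the last letter to the first one. -/

/-- The letters that may follow a word: `0`, and `i + 1` for every `i` that is the last letter
among those that are at least `i`. -/
def allowed : List ℕ → Set ℕ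
  | [] => {0}
  | c :: f => {a | a = 0 ∨ a = c + 1 ∨ (a ∈ allowed f ∧ c + 1 < a)}

/-- Every letter is allowed after the letters preceding it. -/
def IsRich : List ℕ → Prop
  | [] => True
  | c :: f => c ∈ allowed f ∧ IsRich f

/-- The number of different letters of a restricted growth word. -/
def height : List ℕ → ℕ
  | [] => 0
  | c :: f => if c = height f then height f + 1 else height f

/-- Restricted growth words: `i` occurs before `i + 1` does. -/
def IsRestricted : List ℕ → Prop
  | [] => True
  | c :: f => c ≤ height f ∧ IsRestricted f

/-- Increase the first occurrence of each letter and put `0` in front. -/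
def arcBody : List ℕ → List ℕ
  | [] => [0]
  | c :: f => (if c = height f then c + 1 else c) :: arcBody f

/-- The word of the tableau obtained by putting an arc around a noncrossing involution. -/
def arcWord (f : List ℕ) : List ℕ := (height f + 1) :: arcBody f

lemma zero_mem_allowed (f : List ℕ) : 0 ∈ allowed f := by
  cases f <;> simp [allowed]

lemma le_height_of_mem_allowed {f : List ℕ} (hf : IsRestricted f) {a : ℕ} (ha : a ∈ allowed f) :
    a ≤ height f := by
  induction f with
  | nil => simpa [allowed, height] using ha
  | cons c f ih =>
    obtain ⟨hc, hf⟩ := hf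
    have := ih hf
    rcases ha with rfl | rfl | ⟨ha, -⟩
    · simp
    · simp only [height]; split_ifs <;> omega
    · have := ih hf ha
      simp only [height]; split_ifs <;> omega

lemma IsRich.isRestricted {f : List ℕ} (hf : IsRich f) : IsRestricted f := by
  induction f with
  | nil => trivial
  | cons c f ih => exact ⟨le_height_of_mem_allowed (ih hf.2) hf.1, ih hf.2⟩

/-- Earlier letters, which stand at the right end of the list, can only supply a missing
predecessor. This makes rich words closed under concatenation. -/
lemma allowed_subset_append (t p : List ℕ) : allowed t ⊆ allowed (t ++ p) := by
  induction t with
  | nil => intro a ha; obtain rfl : a = 0 := ha; exact zero_mem_allowed _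
  | cons c t ih =>
    rintro a (h | h | ⟨h, h'⟩)
    · exact Or.inl h
    · exact Or.inr (Or.inl h)
    · exact Or.inr (Or.inr ⟨ih h, h'⟩)

lemma IsRich.append {t p : List ℕ} (ht : IsRich t) (hp : IsRich p) : IsRich (t ++ p) := by
  induction t with
  | nil => exact hp
  | cons c t ih => exact ⟨allowed_subset_append t p ht.1, ih ht.2⟩

lemma height_mem_allowed {s : List ℕ} (hs : IsRestricted s) : height s ∈ allowed s := by
  induction s with
  | nil => simp [allowed, height]
  | cons c s ih =>
    obtain ⟨hc, hs⟩ := hs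
    have := ih hs
    simp only [height, allowed, Set.mem_ofPred_eq]
    split_ifs with h
    · omega
    · rcases (show c + 1 = height s ∨ c + 1 < height s by omega) with h | h
      · exact Or.inr (Or.inl h.symm)
      · exact Or.inr (Or.inr ⟨this, h⟩)

/-- The largest letter of `arcBody s` is `height s`, the raised first occurrence of the top letter
of `s` (or the initial `0`), so no later letter can block its successor. -/
lemma height_succ_mem_allowed_arcBody (s q : List ℕ) (hs : IsRestricted s) :
    height s + 1 ∈ allowed (arcBody s ++ q) := by
  induction s with
  | nil => simp [allowed, height, arcBody]
  | cons c s ih =>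
    obtain ⟨hc, hs⟩ := hs
    have := ih hs
    simp only [height, arcBody, List.cons_append, allowed, Set.mem_ofPred_eq]
    split_ifs with h
    · omega
    · exact Or.inr (Or.inr ⟨this, by omega⟩)

/-- Directly after a first occurrence, raised or not, the only allowed letter below the height is
`0`. All other letters agree in `s` and `arcBody s`. -/
lemma mem_allowed_arcBody_iff (s q : List ℕ) (hs : IsRestricted s) {j : ℕ} (hj : j < height s) :
    j ∈ allowed (arcBody s ++ q) ↔ j ∈ allowed s := by
  induction s with
  | nil => simp [height] at hj
  | cons c s ih =>
    obtain ⟨hc, hs⟩ := hs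
    have ih := ih hs
    simp only [height] at hj
    simp only [arcBody, List.cons_append, allowed, Set.mem_ofPred_eq]
    split_ifs at hj ⊢ with h
    · constructor <;> rintro (h | h | h) <;> omega
    · rw [ih hj]

lemma isRich_arcBody_append {s : List ℕ} (hs : IsRestricted s) (q : List ℕ) :
    IsRich (arcBody s ++ q) ↔ IsRich s ∧ IsRich q := by
  induction s with
  | nil => simp [arcBody, IsRich, zero_mem_allowed]
  | cons c s ih =>
    obtain ⟨hc, hs⟩ := hs
    simp only [arcBody, List.cons_append, IsRich, ih hs]
    split_ifs with h
    · simp only [h, height_succ_mem_allowed_arcBody s q hs, height_mem_allowed hs, true_and]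
    · rw [mem_allowed_arcBody_iff s q hs (by omega), and_assoc]

lemma isRich_arcWord {s : List ℕ} (hs : IsRich s) : IsRich (arcWord s) := by
  have h := hs.isRestricted
  have h1 := height_succ_mem_allowed_arcBody s [] h
  have h2 := isRich_arcBody_append h []
  rw [List.append_nil] at h1 h2
  exact ⟨h1, h2.2 ⟨hs, trivial⟩⟩

lemma length_arcBody (s : List ℕ) : (arcBody s).length = s.length + 1 := by
  induction s with
  | nil => rfl
  | cons c s ih => simp [arcBody, ih]

/-- Going backwards from `e + 1`, letters below `e` are skipped until the `e` that permits it; then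
one looks for what permits this `e`, and so on down to a `0`, where the block starts. The letters
met on the descent are the raised first occurrences, the skipped ones are repetitions. -/
lemma exists_eq_arcBody_append {p : List ℕ} (hp : IsRich p) {e : ℕ} (he : e + 1 ∈ allowed p) :
    ∃ s q, IsRestricted s ∧ height s = e ∧ p = arcBody s ++ q := by
  induction p generalizing e with
  | nil => simp [allowed] at he
  | cons c f ih =>
    rcases he with he | he | ⟨he, hlt⟩
    · omega
    · obtain rfl : e = c := by omega
      cases e with
      | zero => exact ⟨[], f, trivial, rfl, rfl⟩
      | succ e =>
        obtain ⟨s, q, hs, rfl, rfl⟩ := ih hp.2 hp.1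
        exact ⟨height s :: s, q, ⟨le_rfl, hs⟩, by simp [height], by simp [arcBody]⟩
    · obtain ⟨s, q, hs, rfl, rfl⟩ := ih hp.2 he
      have : c ≠ height s := by omega
      exact ⟨c :: s, q, ⟨by omega, hs⟩, by simp [height, this], by simp [arcBody, this]⟩

lemma height_pos {c : ℕ} {s : List ℕ} (hs : IsRestricted (c :: s)) : 0 < height (c :: s) := by
  have := hs.1
  simp only [height]; split_ifs <;> omega

/-- With the height known, a last letter equal to it is a raised first occurrence and a smaller one
is a repetition, so the block can be decoded backwards and its beginning is forced. -/
lemma arcBody_append_inj {s s' q q' : List ℕ} (hs : IsRestricted s) (hs' : IsRestricted s')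
    (hh : height s = height s') (h : arcBody s ++ q = arcBody s' ++ q') : s = s' ∧ q = q' := by
  induction s generalizing s' with
  | nil =>
    cases s' with
    | nil => simpa [arcBody] using h
    | cons c' s' => have := height_pos hs'; rw [← hh] at this; simp [height] at this
  | cons c s ih =>
    cases s' with
    | nil => have := height_pos hs; rw [hh] at this; simp [height] at this
    | cons c' s' =>
      obtain ⟨hc, hs⟩ := hs
      obtain ⟨hc', hs'⟩ := hs'
      simp only [arcBody, List.cons_append, List.cons.injEq] at h
      simp only [height] at hh
      have key : c = c' ∧ height s = height s' := by
        obtain ⟨h, -⟩ := h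
        split_ifs at hh h <;> omega
      obtain ⟨rfl, rfl⟩ := ih hs hs' key.2 h.2
      exact ⟨by rw [key.1], rfl⟩

/-! ### Noncrossing involutions as trees -/

/-- Codes of noncrossing involutions: empty, followed by a fixed point, or followed by an arc
around another noncrossing involution. -/
inductive NCTree : Type
  | nil : NCTree
  | fix : NCTree → NCTree
  | arc : NCTree → NCTree → NCTree

namespace NCTree

/-- The size of the encoded involution. -/
def size : NCTree → ℕ
  | nil => 0
  | fix p => p.size + 1
  | arc p s => p.size + (s.size + 2)

/-- The word of row indices of the tableau of the encoded involution. -/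
def rowWord : NCTree → List ℕ
  | nil => []
  | fix p => 0 :: p.rowWord
  | arc p s => arcWord s.rowWord ++ p.rowWord

lemma isRich_rowWord (m : NCTree) : IsRich m.rowWord := by
  induction m with
  | nil => trivial
  | fix p ih => exact ⟨zero_mem_allowed _, ih⟩
  | arc p s ihp ihs => exact (isRich_arcWord ihs).append ihp

lemma length_rowWord (m : NCTree) : m.rowWord.length = m.size := by
  induction m with
  | nil => rfl
  | fix p ih => simp [rowWord, size, ih]
  | arc p s ihp ihs => simp [rowWord, size, arcWord, length_arcBody, ihp, ihs]; omega

/-- The last letter tells a fixed point (`0`) from an arc, and for an arc it gives the height that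
determines where the block starts. -/
lemma rowWord_injective : Function.Injective rowWord := by
  intro m
  induction m with
  | nil => intro m' h; cases m' <;> simp [rowWord, arcWord] at h ⊢
  | fix p ih =>
    intro m' h
    cases m' with
    | nil => simp [rowWord] at h
    | fix p' => rw [ih (List.cons.inj h).2]
    | arc p' s' => simp [rowWord, arcWord] at h
  | arc p s ihp ihs =>
    intro m' h
    cases m' with
    | nil => simp [rowWord, arcWord] at h
    | fix p' => simp [rowWord, arcWord] at h
    | arc p' s' =>
      simp only [rowWord, arcWord, List.cons_append, List.cons.injEq, Nat.add_right_cancel_iff] at h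
      obtain ⟨h1, h2⟩ := arcBody_append_inj s.isRich_rowWord.isRestricted
        s'.isRich_rowWord.isRestricted h.1 h.2
      rw [ihp h2, ihs h1]

lemma exists_rowWord_eq {f : List ℕ} (hf : IsRich f) : ∃ m : NCTree, m.rowWord = f := by
  induction h : f.length using Nat.strong_induction_on generalizing f with
  | _ n ih =>
    subst h
    match f, hf with
    | [], _ => exact ⟨nil, rfl⟩
    | 0 :: f, hf =>
      obtain ⟨m, rfl⟩ := ih _ (by simp) hf.2 rfl
      exact ⟨fix m, rfl⟩
    | (e + 1) :: f, hf =>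
      obtain ⟨s, q, hs, rfl, rfl⟩ := exists_eq_arcBody_append hf.2 hf.1
      obtain ⟨h1, h2⟩ := (isRich_arcBody_append hs q).1 hf.2
      obtain ⟨m, rfl⟩ := ih _ (by simp [length_arcBody]; omega) h1 rfl
      obtain ⟨p, rfl⟩ := ih _ (by simp [length_arcBody]) h2 rfl
      exact ⟨arc p m, rfl⟩

end NCTree

/-! ### Lattice property and primality of arc words -/

/-- Every letter `i + 1` is preceded by a letter `i`. -/
def IsLattice : List ℕ → Prop
  | [] => True
  | c :: t => (∀ i, c = i + 1 → i ∈ t) ∧ IsLattice t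

/-- Membership of the current height in `t` is an invariant of the backward walk: a raised letter
needs its predecessor, the next height, inside `t`, while a repetition differs from the height. So
`t` must reach the initial `0`. -/
lemma eq_nil_of_arcBody_eq_append {s t p : List ℕ} (hs : IsRestricted s) (ht : IsLattice t)
    (hmem : height s ∈ t) (h : arcBody s = t ++ p) : p = [] := by
  induction s generalizing t with
  | nil =>
    cases t with
    | nil => simp at hmem
    | cons c t =>
      simp only [arcBody, List.cons_append, List.cons.injEq, List.nil_eq, List.append_eq_nil_iff] at h
      exact h.2.2
  | cons c s ih =>
    cases t with
    | nil => simp at hmem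
    | cons d t =>
      simp only [arcBody, List.cons_append, List.cons.injEq] at h
      obtain ⟨hc, hs⟩ := hs
      obtain ⟨h1, h2⟩ := h
      refine ih hs ht.2 ?_ h2
      by_cases hch : c = height s
      · rw [if_pos hch] at h1
        rw [← hch]
        exact ht.1 c h1.symm
      · simp only [height, if_neg hch] at h1 hmem
        rcases List.mem_cons.1 hmem with h | h
        · omega
        · exact h

lemma eq_nil_of_arcWord_eq_append {s t p : List ℕ} (hs : IsRestricted s) (ht : IsLattice t)
    (hne : t ≠ []) (h : arcWord s = t ++ p) : p = [] := by
  cases t with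
  | nil => exact absurd rfl hne
  | cons c t =>
    obtain ⟨h1, h2⟩ := List.cons.inj h
    exact eq_nil_of_arcBody_eq_append hs ht.2 (ht.1 _ h1.symm) h2

/-! ### Rows -/

@[simp] lemma row_nil (i : ℕ) : row [] i = [] := by simp [row]

@[simp] lemma row_cons_zero (r : List ℕ) (R : List (List ℕ)) : row (r :: R) 0 = r := by simp [row]

@[simp] lemma row_cons_succ (r : List ℕ) (R : List (List ℕ)) (i : ℕ) :
    row (r :: R) (i + 1) = row R i := by simp [row]

lemma row_eq_getElem {R : List (List ℕ)} {i : ℕ} (h : i < R.length) : row R i = R[i] := by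
  simp [row, h]

lemma row_eq_nil {R : List (List ℕ)} {i : ℕ} (h : R.length ≤ i) : row R i = [] := by
  simp [row, h]

lemma row_mem {R : List (List ℕ)} {i : ℕ} (h : i < R.length) : row R i ∈ R := by
  rw [row_eq_getElem h]; exact List.getElem_mem h

lemma lt_length_of_mem_row {R : List (List ℕ)} {i x : ℕ} (h : x ∈ row R i) : i < R.length := by
  by_contra hi
  simp [row_eq_nil (not_lt.1 hi)] at h

lemma mem_flatten_iff_mem_row {R : List (List ℕ)} {x : ℕ} :
    x ∈ R.flatten ↔ ∃ i, x ∈ row R i := by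
  rw [List.mem_flatten]
  constructor
  · rintro ⟨r, hr, hx⟩
    obtain ⟨i, hi, rfl⟩ := List.getElem_of_mem hr
    exact ⟨i, by rwa [row_eq_getElem hi]⟩
  · rintro ⟨i, hx⟩
    exact ⟨_, row_mem (lt_length_of_mem_row hx), hx⟩

/-- A list of nonempty increasing rows is determined by the sets of entries of its rows. -/
lemma eq_of_mem_row_iff {R S : List (List ℕ)} (hR : ∀ r ∈ R, r ≠ []) (hS : ∀ r ∈ S, r ≠ [])
    (hR' : ∀ i, (row R i).Pairwise (· < ·)) (hS' : ∀ i, (row S i).Pairwise (· < ·))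
    (h : ∀ x i, x ∈ row R i ↔ x ∈ row S i) : R = S := by
  have hrow : ∀ i, row R i = row S i := fun i =>
    List.Perm.eq_of_pairwise (fun a b _ _ h1 h2 => absurd (h1.trans h2) (lt_irrefl a)) (hR' i) (hS' i)
      ((List.perm_ext_iff_of_nodup ((hR' i).imp ne_of_lt) ((hS' i).imp ne_of_lt)).2
        fun x => h x i)
  clear h hR' hS'
  induction R generalizing S with
  | nil =>
    cases S with
    | nil => rfl
    | cons s S => exact absurd (by simpa using (hrow 0).symm) (hS s (by simp))
  | cons r R ih =>
    cases S with
    | nil => exact absurd (by simpa using hrow 0) (hR r (by simp))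
    | cons s S =>
      rw [show r = s by simpa using hrow 0,
        ih (S := S) (fun r hr => hR r (List.mem_cons_of_mem _ hr))
          (fun r hr => hS r (List.mem_cons_of_mem _ hr))
          (fun i => by simpa using hrow (i + 1))]

/-! ### Standard tableaux -/

lemma row_rowsOf {μ : YoungDiagram} (T : SemistandardYoungTableau μ) (i : ℕ) :
    row (rowsOf T) i = (List.range (μ.rowLen i)).map fun j => T i j := by
  by_cases hi : i < μ.colLen 0
  · rw [row_eq_getElem (by simpa [rowsOf] using hi)]
    simp [rowsOf]
  · rw [row_eq_nil (by simpa [rowsOf] using hi)]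
    have : ¬ 0 < μ.rowLen i := by
      rwa [← YoungDiagram.mem_iff_lt_rowLen, YoungDiagram.mem_iff_lt_colLen]
    simp [show μ.rowLen i = 0 by omega]

namespace IsStandard

variable {n : ℕ} {R : List (List ℕ)}

lemma ne_nil (h : IsStandard n R) : ∀ r ∈ R, r ≠ [] := by
  obtain ⟨⟨μ, T, rfl⟩, -⟩ := h
  intro r hr
  simp only [rowsOf, List.mem_map, List.mem_range] at hr
  obtain ⟨i, hi, rfl⟩ := hr
  rw [← YoungDiagram.mem_iff_lt_colLen, YoungDiagram.mem_iff_lt_rowLen] at hi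
  simp; omega

lemma nodup_flatten (h : IsStandard n R) : R.flatten.Nodup :=
  h.2.nodup_iff.2 List.nodup_range'

lemma pairwise_row (h : IsStandard n R) (i : ℕ) : (row R i).Pairwise (· < ·) := by
  have hnd : (row R i).Nodup := by
    by_cases hi : i < R.length
    · exact (List.nodup_flatten.1 h.nodup_flatten).1 _ (row_mem hi)
    · simp [row_eq_nil (not_lt.1 hi)]
  obtain ⟨⟨μ, T, rfl⟩, -⟩ := h
  rw [row_rowsOf] at hnd ⊢
  rw [List.pairwise_iff_getElem]
  intro j k hj hk hjk
  refine lt_of_le_of_ne ?_ fun h => hjk.ne ((List.Nodup.getElem_inj_iff hnd).1 h)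
  simp only [List.length_map, List.length_range] at hk
  simpa using T.row_weak hjk (YoungDiagram.mem_iff_lt_rowLen.2 hk)

lemma exists_lt_mem_row (h : IsStandard n R) {i x : ℕ} (hx : x ∈ row R (i + 1)) :
    ∃ y ∈ row R i, y < x := by
  obtain ⟨⟨μ, T, rfl⟩, -⟩ := h
  rw [row_rowsOf] at hx ⊢
  simp only [List.mem_map, List.mem_range] at hx
  obtain ⟨j, hj, rfl⟩ := hx
  refine ⟨T i j, ?_, T.col_strict (Nat.lt_succ_self i) (YoungDiagram.mem_iff_lt_rowLen.2 hj)⟩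
  exact List.mem_map.2 ⟨j, List.mem_range.2 (hj.trans_le (μ.rowLen_anti _ _ (Nat.le_succ i))), rfl⟩

lemma exists_mem_row_iff (h : IsStandard n R) {x : ℕ} : (∃ i, x ∈ row R i) ↔ 1 ≤ x ∧ x ≤ n := by
  rw [← mem_flatten_iff_mem_row, h.2.mem_iff, List.mem_range'_1]
  omega

lemma eq_of_mem_row (h : IsStandard n R) {x i k : ℕ} (hi : x ∈ row R i) (hk : x ∈ row R k) :
    i = k := by
  have hp := List.pairwise_iff_getElem.1 (List.nodup_flatten.1 h.nodup_flatten).2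
  have hi' := lt_length_of_mem_row hi
  have hk' := lt_length_of_mem_row hk
  rw [row_eq_getElem hi'] at hi
  rw [row_eq_getElem hk'] at hk
  rcases lt_trichotomy i k with hlt | heq | hlt
  · exact (hp i k hi' hk' hlt hi hk).elim
  · exact heq
  · exact (hp k i hk' hi' hlt hk hi).elim

end IsStandard

lemma exists_eq_rowsOf {R : List (List ℕ)} (hne : ∀ r ∈ R, r ≠ [])
    (hrow : ∀ i, (row R i).Pairwise (· < ·))
    (hcol : ∀ i j, ∀ h : j < (row R (i + 1)).length,
      ∃ h' : j < (row R i).length, (row R i)[j] < (row R (i + 1))[j]) :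
    ∃ (μ : YoungDiagram) (T : SemistandardYoungTableau μ), R = rowsOf T := by
  have hlen : Antitone fun i => (row R i).length := antitone_nat_of_succ_le fun i => by
    by_contra! h
    -- A longer row `i + 1` would have an entry at position `(row R i).length`, and the column
    -- condition puts that position inside row `i`.
    obtain ⟨h', -⟩ := hcol i _ h
    exact lt_irrefl _ h'
  have hsort : (R.map List.length).SortedGE := by
    rw [List.sortedGE_iff_pairwise, List.pairwise_iff_getElem]
    intro i j hi hj hij
    simp only [List.length_map] at hi hj
    have := hlen hij.le
    simpa [row_eq_getElem hi, row_eq_getElem hj] using this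
  have hmem : ∀ i j, (i, j) ∈ YoungDiagram.ofRowLens _ hsort ↔ j < (row R i).length := by
    intro i j
    rw [YoungDiagram.mem_ofRowLens]
    constructor
    · rintro ⟨h, h'⟩
      simp only [List.length_map] at h
      rw [row_eq_getElem h]
      simpa using h'
    · intro h
      have hi : i < R.length := by
        by_contra hi
        simp [row_eq_nil (not_lt.1 hi)] at h
      rw [row_eq_getElem hi] at h
      exact ⟨by simpa using hi, by simpa using h⟩
  have hcol' : ∀ i k j, i < k → ∀ h : j < (row R k).length,
      ∃ h' : j < (row R i).length, (row R i)[j] < (row R k)[j] := by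
    intro i k j hik
    induction k, hik using Nat.le_induction with
    | base => exact hcol i j
    | succ k _ ih =>
      intro h
      obtain ⟨h1, h2⟩ := hcol k j h
      obtain ⟨h3, h4⟩ := ih h1
      exact ⟨h3, h4.trans h2⟩
  refine ⟨YoungDiagram.ofRowLens _ hsort, ⟨fun i j => (row R i).getD j 0, ?_, ?_, ?_⟩, ?_⟩
  · intro i j k hjk hk
    rw [hmem] at hk
    rw [List.getD_eq_getElem _ _ hk, List.getD_eq_getElem _ _ (hjk.trans hk)]
    exact (List.pairwise_iff_getElem.1 (hrow i) _ _ _ _ hjk).le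
  · intro i k j hik hk
    rw [hmem] at hk
    obtain ⟨h1, h2⟩ := hcol' i k j hik hk
    rwa [List.getD_eq_getElem _ _ hk, List.getD_eq_getElem _ _ h1]
  · intro i j h
    rw [hmem] at h
    exact List.getD_eq_default _ _ (not_lt.1 h)
  · have hcolLen : (YoungDiagram.ofRowLens _ hsort).colLen 0 = R.length := by
      refine eq_of_forall_lt_iff fun i => ?_
      rw [← YoungDiagram.mem_iff_lt_colLen, hmem]
      constructor
      · intro h
        by_contra hi
        simp [row_eq_nil (not_lt.1 hi)] at h
      · intro h
        exact List.length_pos_iff.2 (hne _ (row_mem h))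
    have hrowLen : ∀ i, (YoungDiagram.ofRowLens _ hsort).rowLen i = (row R i).length := fun i =>
      eq_of_forall_lt_iff fun j => by rw [← YoungDiagram.mem_iff_lt_rowLen, hmem]
    refine List.ext_getElem (by simp [rowsOf, hcolLen]) fun i h1 h2 => ?_
    simp only [rowsOf, List.getElem_map, List.getElem_range, hrowLen]
    rw [← row_eq_getElem h1]
    refine List.ext_getElem (by simp) fun j h3 h4 => ?_
    simp only [List.getElem_map, List.getElem_range]
    exact (List.getD_eq_getElem _ _ h3).symm

/-! ### The row words of tableaux -/

/-- The `x`-th letter of the word `f` (written from the last letter to the first) is `i`. -/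
def LetterAt : List ℕ → ℕ → ℕ → Prop
  | [], _, _ => False
  | c :: f, x, i => (x = f.length + 1 ∧ i = c) ∨ LetterAt f x i

lemma LetterAt.pos_le {f : List ℕ} {x i : ℕ} (h : LetterAt f x i) : 1 ≤ x ∧ x ≤ f.length := by
  induction f with
  | nil => exact h.elim
  | cons c f ih =>
    rcases h with ⟨rfl, -⟩ | h
    · simp
    · have := ih h
      simp only [List.length_cons]; omega

lemma letterAt_unique {f : List ℕ} {x i k : ℕ} (h : LetterAt f x i) (h' : LetterAt f x k) :
    i = k := by
  induction f with
  | nil => exact h.elim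
  | cons c f ih =>
    rcases h with ⟨hx, rfl⟩ | h
    · rcases h' with ⟨-, rfl⟩ | h'
      · rfl
      · have := h'.pos_le; omega
    · rcases h' with ⟨hx, -⟩ | h'
      · have := h.pos_le; omega
      · exact ih h h'

lemma letterAt_cons_iff_of_le {c : ℕ} {f : List ℕ} {x i : ℕ} (hx : x ≤ f.length) :
    LetterAt (c :: f) x i ↔ LetterAt f x i :=
  ⟨fun h => h.resolve_left fun h => by omega, Or.inr⟩

lemma eq_of_letterAt_iff {f g : List ℕ} (h : ∀ x i, LetterAt f x i ↔ LetterAt g x i) : f = g := by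
  induction f generalizing g with
  | nil =>
    cases g with
    | nil => rfl
    | cons d g => exact ((h _ d).2 (Or.inl ⟨rfl, rfl⟩)).elim
  | cons c f ih =>
    cases g with
    | nil => exact ((h _ c).1 (Or.inl ⟨rfl, rfl⟩)).elim
    | cons d g =>
      have h1 := (h _ c).1 (Or.inl ⟨rfl, rfl⟩)
      have h2 := (h _ d).2 (Or.inl ⟨rfl, rfl⟩)
      have h3 := h1.pos_le
      have h4 := h2.pos_le
      simp only [List.length_cons] at h3 h4
      have hcd : c = d := by
        rcases h1 with h1 | h1
        · exact h1.2
        · have := h1.pos_le; omega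
      rw [hcd, ih fun x i => ?_]
      constructor
      · intro hx
        have := hx.pos_le
        exact (letterAt_cons_iff_of_le (by omega)).1 ((h x i).1 (Or.inr hx))
      · intro hx
        have := hx.pos_le
        exact (letterAt_cons_iff_of_le (by omega)).1 ((h x i).2 (Or.inr hx))

lemma letterAt_append {t p : List ℕ} {x i : ℕ} :
    LetterAt (t ++ p) x i ↔ LetterAt p x i ∨ ∃ y, LetterAt t y i ∧ y + p.length = x := by
  induction t with
  | nil => simp [LetterAt]
  | cons c t ih =>
    simp only [List.cons_append, LetterAt, ih, List.length_append]
    constructor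
    · rintro (⟨rfl, rfl⟩ | h | ⟨y, h, rfl⟩)
      · exact Or.inr ⟨_, Or.inl ⟨rfl, rfl⟩, by omega⟩
      · exact Or.inl h
      · exact Or.inr ⟨y, Or.inr h, rfl⟩
    · rintro (h | ⟨y, ⟨rfl, rfl⟩ | h, rfl⟩)
      · exact Or.inr (Or.inl h)
      · exact Or.inl ⟨by omega, rfl⟩
      · exact Or.inr (Or.inr ⟨y, h, rfl⟩)

lemma LetterAt.mem {f : List ℕ} {x i : ℕ} (h : LetterAt f x i) : i ∈ f := by
  induction f with
  | nil => exact h.elim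
  | cons c f ih =>
    rcases h with ⟨-, rfl⟩ | h
    · simp
    · simp [ih h]

lemma isLattice_of_letterAt {f : List ℕ}
    (h : ∀ x i, LetterAt f x (i + 1) → ∃ y < x, LetterAt f y i) : IsLattice f := by
  induction f with
  | nil => trivial
  | cons c f ih =>
    refine ⟨?_, ih fun x i hx => ?_⟩
    · rintro i rfl
      obtain ⟨y, hy, hyi⟩ := h _ i (Or.inl ⟨rfl, rfl⟩)
      exact ((letterAt_cons_iff_of_le (by omega)).1 hyi).mem
    · have := hx.pos_le
      obtain ⟨y, hy, hyi⟩ := h x i (Or.inr hx)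
      exact ⟨y, hy, (letterAt_cons_iff_of_le (by omega)).1 hyi⟩

lemma succ_mem_allowed_iff {f : List ℕ} {i : ℕ} :
    i + 1 ∈ allowed f ↔ ∃ m, LetterAt f m i ∧ ∀ x k, LetterAt f x k → m < x → k < i := by
  induction f with
  | nil => simp [allowed, LetterAt]
  | cons c f ih =>
    constructor
    · rintro (h | h | ⟨h, hlt⟩)
      · omega
      · obtain rfl : i = c := by omega
        refine ⟨_, Or.inl ⟨rfl, rfl⟩, fun x k hx hlt => ?_⟩
        have := hx.pos_le
        simp only [List.length_cons] at this
        omega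
      · obtain ⟨m, hm, hmax⟩ := ih.1 h
        refine ⟨m, Or.inr hm, ?_⟩
        rintro x k (⟨rfl, rfl⟩ | hx) hmx
        · omega
        · exact hmax x k hx hmx
    · rintro ⟨m, ⟨rfl, rfl⟩ | hm, hmax⟩
      · exact Or.inr (Or.inl rfl)
      · have hml := hm.pos_le
        have := hmax _ c (Or.inl ⟨rfl, rfl⟩) (by omega)
        exact Or.inr (Or.inr ⟨ih.2 ⟨m, hm, fun x k hx => hmax x k (Or.inr hx)⟩, by omega⟩)

lemma isRich_iff {f : List ℕ} :
    IsRich f ↔ ∀ j i, LetterAt f j (i + 1) →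
      ∃ m, LetterAt f m i ∧ m < j ∧ ∀ x k, LetterAt f x k → m < x → x < j → k < i := by
  induction f with
  | nil => simp [IsRich, LetterAt]
  | cons c f ih =>
    constructor
    · rintro ⟨hc, hf⟩ j i (⟨rfl, rfl⟩ | hj)
      · obtain ⟨m, hm, hmax⟩ := succ_mem_allowed_iff.1 hc
        have := hm.pos_le
        refine ⟨m, Or.inr hm, by omega, fun x k hx hmx hxj => ?_⟩
        exact hmax x k ((letterAt_cons_iff_of_le (by omega)).1 hx) hmx
      · obtain ⟨m, hm, hmj, hmax⟩ := ih.1 hf j i hj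
        have := hj.pos_le
        refine ⟨m, Or.inr hm, hmj, fun x k hx hmx hxj => ?_⟩
        exact hmax x k ((letterAt_cons_iff_of_le (by omega)).1 hx) hmx hxj
    · intro h
      refine ⟨?_, ih.2 fun j i hj => ?_⟩
      · cases c with
        | zero => exact zero_mem_allowed _
        | succ i =>
          obtain ⟨m, hm, hmj, hmax⟩ := h _ i (Or.inl ⟨rfl, rfl⟩)
          refine succ_mem_allowed_iff.2
            ⟨m, (letterAt_cons_iff_of_le (by omega)).1 hm, fun x k hx hmx => ?_⟩
          have := hx.pos_le
          exact hmax x k (Or.inr hx) hmx (by omega)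
      · have := hj.pos_le
        obtain ⟨m, hm, hmj, hmax⟩ := h j i (Or.inr hj)
        exact ⟨m, (letterAt_cons_iff_of_le (by omega)).1 hm, hmj,
          fun x k hx => hmax x k (Or.inr hx)⟩

/-- Maximality of `m` excludes row `i`, and the second clause excludes all lower rows, for entries
between `m` and `j`. Together they say that the letters strictly between are less than `i`. -/
lemma richardsonCondition_iff {R : List (List ℕ)} {f : List ℕ}
    (h : ∀ x i, x ∈ row R i ↔ LetterAt f x i) : RichardsonCondition R ↔ IsRich f := by
  rw [isRich_iff]
  constructor
  · intro hR j i hj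
    obtain ⟨m, ⟨⟨hm, hmj⟩, hmax⟩, hbelow⟩ := hR i j ((h _ _).2 hj)
    refine ⟨m, (h _ _).1 hm, hmj, fun x k hx hmx hxj => ?_⟩
    by_contra! hk
    rcases hk.eq_or_lt with rfl | hk
    · exact absurd (hmax ⟨(h _ _).2 hx, hxj⟩) (by omega)
    · exact absurd (hbelow k hk x ((h _ _).2 hx) hxj) (by omega)
  · intro hf i j hj
    obtain ⟨m, hm, hmj, hmax⟩ := hf j i ((h _ _).1 hj)
    refine ⟨m, ⟨⟨(h _ _).2 hm, hmj⟩, ?_⟩, fun k hk x hx hxj => ?_⟩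
    · rintro x ⟨hx, hxj⟩
      by_contra! hmx
      exact lt_irrefl i (hmax x i ((h _ _).1 hx) hmx hxj)
    · by_contra! hmx
      rcases hmx.eq_or_lt with rfl | hmx
      · exact absurd ((h _ _).1 hx) fun h' => by
          have := letterAt_unique hm h'
          omega
      · have := hmax x k ((h _ _).1 hx) hmx hxj
        omega

/-- The word with letters `g 1, …, g n`. -/
def wordOf (g : ℕ → ℕ) : ℕ → List ℕ
  | 0 => []
  | n + 1 => g (n + 1) :: wordOf g n

lemma length_wordOf (g : ℕ → ℕ) (n : ℕ) : (wordOf g n).length = n := by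
  induction n with
  | zero => rfl
  | succ n ih => simp [wordOf, ih]

lemma letterAt_wordOf {g : ℕ → ℕ} {n x i : ℕ} :
    LetterAt (wordOf g n) x i ↔ (1 ≤ x ∧ x ≤ n) ∧ g x = i := by
  induction n with
  | zero => simp [wordOf, LetterAt]; omega
  | succ n ih =>
    simp only [wordOf, LetterAt, ih, length_wordOf]
    constructor
    · rintro (⟨rfl, rfl⟩ | ⟨h, rfl⟩)
      · exact ⟨by omega, rfl⟩
      · exact ⟨by omega, rfl⟩
    · rintro ⟨h, rfl⟩
      rcases (show x = n + 1 ∨ x ≤ n by omega) with rfl | h'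
      · exact Or.inl ⟨rfl, rfl⟩
      · exact Or.inr ⟨⟨h.1, h'⟩, rfl⟩

lemma IsStandard.exists_word {n : ℕ} {R : List (List ℕ)} (h : IsStandard n R) :
    ∃ f : List ℕ, f.length = n ∧ IsLattice f ∧ ∀ x i, x ∈ row R i ↔ LetterAt f x i := by
  classical
  -- The default `0` is never read by `wordOf g n`, since each of `1, …, n` lies in some row.
  let g : ℕ → ℕ := fun x => if hx : ∃ i, x ∈ row R i then hx.choose else 0
  have hg : ∀ x i, x ∈ row R i ↔ LetterAt (wordOf g n) x i := by
    intro x i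
    rw [letterAt_wordOf, ← h.exists_mem_row_iff]
    constructor
    · intro hx
      have hx' : ∃ i, x ∈ row R i := ⟨i, hx⟩
      refine ⟨hx', ?_⟩
      simp only [g, dif_pos hx']
      exact h.eq_of_mem_row hx'.choose_spec hx
    · rintro ⟨hx, rfl⟩
      simp only [g, dif_pos hx]
      exact hx.choose_spec
  refine ⟨wordOf g n, length_wordOf _ _, isLattice_of_letterAt fun x i hx => ?_, hg⟩
  obtain ⟨y, hy, hyx⟩ := h.exists_lt_mem_row ((hg _ _).2 hx)
  exact ⟨y, hyx, (hg _ _).1 hy⟩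

/-! ### The tableau of a word -/

/-- Append `x` to row `c`. -/
def addAt : ℕ → ℕ → List (List ℕ) → List (List ℕ)
  | 0, x, [] => [[x]]
  | 0, x, r :: R => (r ++ [x]) :: R
  | c + 1, x, [] => [] :: addAt c x []
  | c + 1, x, r :: R => r :: addAt c x R

/-- The tableau whose entry `x` lies in the row given by the `x`-th letter. -/
def tab : List ℕ → List (List ℕ)
  | [] => []
  | c :: f => addAt c (f.length + 1) (tab f)

lemma row_addAt (c x : ℕ) (R : List (List ℕ)) (i : ℕ) :
    row (addAt c x R) i = if i = c then row R i ++ [x] else row R i := by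
  induction c generalizing R i with
  | zero => cases R <;> cases i <;> simp [addAt]
  | succ c ih => cases R <;> cases i <;> simp [addAt, ih]

lemma length_addAt {c x : ℕ} {R : List (List ℕ)} (hc : c ≤ R.length) :
    (addAt c x R).length = if c = R.length then R.length + 1 else R.length := by
  induction c generalizing R with
  | zero => cases R <;> simp [addAt]
  | succ c ih =>
    cases R with
    | nil => simp at hc
    | cons r R =>
      simp only [List.length_cons] at hc
      simp only [addAt, List.length_cons, ih (R := R) (by omega), Nat.add_right_cancel_iff]
      split_ifs <;> rfl

lemma addAt_ne_nil {c x : ℕ} {R : List (List ℕ)} (hc : c ≤ R.length) (hR : ∀ r ∈ R, r ≠ []) :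
    ∀ r ∈ addAt c x R, r ≠ [] := by
  induction c generalizing R with
  | zero =>
    cases R with
    | nil => simp [addAt]
    | cons r R => simp only [addAt, List.mem_cons, forall_eq_or_imp] at hR ⊢; exact ⟨by simp, hR.2⟩
  | succ c ih =>
    cases R with
    | nil => simp at hc
    | cons r R =>
      simp only [addAt, List.mem_cons, forall_eq_or_imp] at hR ⊢
      exact ⟨hR.1, ih (by simpa using hc) hR.2⟩

lemma flatten_addAt_perm (c x : ℕ) (R : List (List ℕ)) :
    (addAt c x R).flatten.Perm (x :: R.flatten) := by
  induction c generalizing R with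
  | zero =>
    cases R with
    | nil => simp [addAt]
    | cons r R =>
      simp only [addAt, List.flatten_cons, List.append_assoc, List.singleton_append]
      exact List.perm_middle
  | succ c ih =>
    cases R with
    | nil => simpa [addAt] using ih []
    | cons r R =>
      simp only [addAt, List.flatten_cons]
      exact ((ih R).append_left r).trans List.perm_middle

lemma mem_row_tab {f : List ℕ} {x i : ℕ} : x ∈ row (tab f) i ↔ LetterAt f x i := by
  induction f with
  | nil => simp [tab, LetterAt]
  | cons c f ih =>
    simp only [tab, LetterAt, row_addAt, ← ih]
    split_ifs with h <;> simp [h, or_comm]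

lemma pairwise_row_tab (f : List ℕ) (i : ℕ) : (row (tab f) i).Pairwise (· < ·) := by
  induction f with
  | nil => simp [tab]
  | cons c f ih =>
    simp only [tab, row_addAt]
    split_ifs with h
    · rw [List.pairwise_append]
      refine ⟨ih, by simp, fun a ha b hb => ?_⟩
      obtain rfl := List.mem_singleton.1 hb
      have := (mem_row_tab.1 ha).pos_le
      omega
    · exact ih

lemma flatten_tab_perm (f : List ℕ) : (tab f).flatten.Perm (List.range' 1 f.length) := by
  induction f with
  | nil => simp [tab]
  | cons c f ih =>
    rw [tab, List.length_cons, List.range'_1_concat]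
    refine (flatten_addAt_perm _ _ _).trans ((ih.cons _).trans ?_)
    rw [add_comm 1]
    exact (List.perm_append_singleton _ _).symm

lemma length_tab {f : List ℕ} (hf : IsRestricted f) : (tab f).length = height f := by
  induction f with
  | nil => rfl
  | cons c f ih =>
    have := ih hf.2
    rw [tab, length_addAt (by rw [this]; exact hf.1), this, height]

lemma tab_ne_nil {f : List ℕ} (hf : IsRestricted f) : ∀ r ∈ tab f, r ≠ [] := by
  induction f with
  | nil => simp [tab]
  | cons c f ih => exact addAt_ne_nil (by rw [length_tab hf.2]; exact hf.1) (ih hf.2)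

lemma isStandard_tab {f : List ℕ} (hf : IsRich f) : IsStandard f.length (tab f) := by
  refine ⟨exists_eq_rowsOf (tab_ne_nil hf.isRestricted) (pairwise_row_tab f) fun i j => ?_,
    flatten_tab_perm f⟩
  have hp := List.pairwise_iff_getElem.1 (pairwise_row_tab f i)
  have hp' := List.pairwise_iff_getElem.1 (pairwise_row_tab f (i + 1))
  have hR := isRich_iff.1 hf
  induction j with
  | zero =>
    intro h
    obtain ⟨m, hm, hmj, -⟩ := hR _ i (mem_row_tab.1 (List.getElem_mem h))
    obtain ⟨t, ht, rfl⟩ := List.getElem_of_mem (mem_row_tab.2 hm)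
    refine ⟨by omega, ?_⟩
    rcases t.eq_zero_or_pos with rfl | h0
    · exact hmj
    · exact (hp 0 t _ ht h0).trans hmj
  | succ j ih =>
    intro h
    obtain ⟨h1, h2⟩ := ih (by omega)
    obtain ⟨m, hm, hmj, hmax⟩ := hR _ i (mem_row_tab.1 (List.getElem_mem h))
    obtain ⟨t, ht, rfl⟩ := List.getElem_of_mem (mem_row_tab.2 hm)
    -- Otherwise the entry of row `i + 1` in column `j` would lie strictly between `m` and the next
    -- entry of its row, where only letters below `i` may occur.
    have hjt : j < t := by
      by_contra! htj
      have h3 : (row (tab f) i)[t] ≤ (row (tab f) i)[j] := by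
        rcases htj.eq_or_lt with rfl | htj
        · exact le_rfl
        · exact (hp t j _ _ htj).le
      have := hmax _ (i + 1) (mem_row_tab.1 (List.getElem_mem (n := j) (by omega))) (h3.trans_lt h2)
        (hp' j (j + 1) _ h (by omega))
      omega
    refine ⟨by omega, ?_⟩
    rcases (show t = j + 1 ∨ j + 1 < t by omega) with rfl | h0
    · exact hmj
    · exact (hp _ t _ ht h0).trans hmj

lemma mem_RT_iff {n : ℕ} {R : List (List ℕ)} :
    R ∈ RT n ↔ ∃ f, IsRich f ∧ f.length = n ∧ tab f = R := by
  constructor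
  · rintro ⟨h, hR⟩
    obtain ⟨f, hn, -, hf⟩ := h.exists_word
    have hrich := (richardsonCondition_iff hf).1 hR
    refine ⟨f, hrich, hn, ?_⟩
    exact eq_of_mem_row_iff (tab_ne_nil hrich.isRestricted) h.ne_nil (pairwise_row_tab f)
      h.pairwise_row fun x i => by rw [mem_row_tab, hf]
  · rintro ⟨f, hf, rfl, rfl⟩
    exact ⟨isStandard_tab hf, (richardsonCondition_iff fun x i => mem_row_tab).2 hf⟩

lemma tab_injective : Function.Injective tab := fun f g h =>
  eq_of_letterAt_iff fun x i => by rw [← mem_row_tab, h, mem_row_tab]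

/-! ### Concatenation -/

lemma appendRows_nil (R : List (List ℕ)) : appendRows R [] = R := by cases R <;> rfl

lemma row_appendRows (R S : List (List ℕ)) (i : ℕ) :
    row (appendRows R S) i = row R i ++ row S i := by
  induction R generalizing S i with
  | nil => simp [appendRows]
  | cons r R ih => cases S <;> cases i <;> simp [appendRows, ih]

lemma row_map_map (S : List (List ℕ)) (a i : ℕ) :
    row (S.map fun s => s.map (· + a)) i = (row S i).map (· + a) := by
  induction S generalizing i with
  | nil => simp
  | cons s S ih => cases i <;> simp [ih]

lemma addAt_appendRows (c x : ℕ) (R S : List (List ℕ)) :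
    addAt c x (appendRows R S) = appendRows R (addAt c x S) := by
  induction c generalizing R S with
  | zero => cases R <;> cases S <;> simp [addAt, appendRows, appendRows_nil]
  | succ c ih =>
    cases R with
    | nil => rfl
    | cons r R =>
      cases S with
      | nil =>
        have := ih R []
        rw [appendRows_nil] at this
        simp [addAt, appendRows, this]
      | cons s S => simp [addAt, appendRows, ih]

lemma map_addAt (c x a : ℕ) (S : List (List ℕ)) :
    (addAt c x S).map (fun s => s.map (· + a)) =
      addAt c (x + a) (S.map fun s => s.map (· + a)) := by
  induction c generalizing S with
  | zero => cases S <;> simp [addAt]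
  | succ c ih =>
    cases S with
    | nil => simpa [addAt] using ih []
    | cons s S => simp [addAt, ih]

lemma tab_append (t p : List ℕ) : tab (t ++ p) = concat p.length (tab p) (tab t) := by
  induction t with
  | nil => simp [concat, tab, appendRows_nil]
  | cons c t ih =>
    rw [List.cons_append, tab, ih, tab, concat, concat, map_addAt, addAt_appendRows,
      List.length_append]
    congr 2
    omega

/-- A concatenation of standard tableaux splits the word, and column strictness makes the word `t`
of the second factor a lattice word. -/
lemma isPrimeTableau_tab {f : List ℕ}
    (hf : ∀ t p, IsLattice t → t ≠ [] → f = t ++ p → p = []) : IsPrimeTableau (tab f) := by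
  rintro ⟨a, b, P, Q, ha, hb, hP, hQ, h⟩
  obtain ⟨p, rfl, -, hp⟩ := hP.exists_word
  obtain ⟨t, rfl, htl, ht⟩ := hQ.exists_word
  have : f = t ++ p := eq_of_letterAt_iff fun x i => by
    rw [← mem_row_tab, h, concat, row_appendRows, row_map_map, letterAt_append, List.mem_append, hp]
    simp [ht]
  rw [hf t p htl (List.length_pos_iff.1 hb) this] at ha
  simp at ha

lemma isPrimeTableau_tab_arcWord {s : List ℕ} (hs : IsRestricted s) :
    IsPrimeTableau (tab (arcWord s)) :=
  isPrimeTableau_tab fun _ _ ht hne h => eq_nil_of_arcWord_eq_append hs ht hne h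

lemma isPrimeTableau_tab_singleton : IsPrimeTableau (tab [0]) :=
  isPrimeTableau_tab fun t p _ hne h => by
    cases t with
    | nil => exact absurd rfl hne
    | cons c t => exact (List.append_eq_nil_iff.1 (List.cons.inj h).2.symm).2

/-! ### Insertion -/

lemma rowInsert_map (x a : ℕ) (r : List ℕ) :
    rowInsert (x + a) (r.map (· + a)) =
      ((rowInsert x r).1.map (· + a), (rowInsert x r).2.map (· + a)) := by
  induction r with
  | nil => simp [rowInsert]
  | cons y r ih =>
    simp only [List.map_cons, rowInsert, Nat.add_lt_add_iff_right, ih]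
    split_ifs <;> simp

lemma insertEntry_cons (r : List ℕ) (R : List (List ℕ)) (x : ℕ) :
    insertEntry (r :: R) x = (rowInsert x r).1 ::
      (match (rowInsert x r).2 with | none => R | some y => insertEntry R y) := by
  rw [insertEntry]
  rcases h : rowInsert x r with ⟨r', _ | y⟩ <;> simp

lemma insertEntry_map (R : List (List ℕ)) (x a : ℕ) :
    insertEntry (R.map fun r => r.map (· + a)) (x + a) =
      (insertEntry R x).map fun r => r.map (· + a) := by
  induction R generalizing x with
  | nil => simp [insertEntry]
  | cons r R ih =>
    rw [List.map_cons, insertEntry_cons, insertEntry_cons, rowInsert_map]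
    rcases (rowInsert x r).2 with _ | y <;> simp [ih]

lemma foldl_insertEntry_map (l : List ℕ) (R : List (List ℕ)) (a : ℕ) :
    (l.map (· + a)).foldl insertEntry (R.map fun r => r.map (· + a)) =
      (l.foldl insertEntry R).map fun r => r.map (· + a) := by
  induction l generalizing R with
  | nil => rfl
  | cons x l ih => simp only [List.map_cons, List.foldl_cons, insertEntry_map, ih]

lemma rowInsert_append {r : List ℕ} {x : ℕ} (s : List ℕ) (h : ∀ y ∈ r, y ≤ x) :
    rowInsert x (r ++ s) = (r ++ (rowInsert x s).1, (rowInsert x s).2) := by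
  induction r with
  | nil => simp
  | cons y r ih =>
    simp only [List.mem_cons, forall_eq_or_imp] at h
    simp [rowInsert, ih h.2, not_lt.2 h.1]

lemma mem_of_rowInsert_snd {x y : ℕ} {r : List ℕ} (h : (rowInsert x r).2 = some y) : y ∈ r := by
  induction r with
  | nil => simp [rowInsert] at h
  | cons z r ih =>
    simp only [rowInsert] at h
    split_ifs at h
    · simp at h; simp [h]
    · exact List.mem_cons_of_mem _ (ih h)

lemma mem_of_mem_rowInsert_fst {x y : ℕ} {r : List ℕ} (h : y ∈ (rowInsert x r).1) :
    y = x ∨ y ∈ r := by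
  induction r with
  | nil => simpa [rowInsert] using h
  | cons z r ih =>
    simp only [rowInsert] at h
    split_ifs at h
    · simp at h ⊢; tauto
    · simp at h ⊢; tauto

lemma mem_of_mem_insertEntry {R : List (List ℕ)} {x y : ℕ} (h : y ∈ (insertEntry R x).flatten) :
    y = x ∨ y ∈ R.flatten := by
  induction R generalizing x with
  | nil => simpa [insertEntry] using h
  | cons r R ih =>
    rw [insertEntry_cons, List.flatten_cons, List.mem_append] at h
    rw [List.flatten_cons, List.mem_append]
    rcases h with h | h
    · rcases mem_of_mem_rowInsert_fst h with h | h <;> simp [h]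
    · rcases hr : (rowInsert x r).2 with _ | z
      · simp only [hr] at h; simp [h]
      · simp only [hr] at h
        rcases ih h with rfl | h
        · simp [mem_of_rowInsert_snd hr]
        · simp [h]

lemma mem_of_mem_foldl_insertEntry {l : List ℕ} {R : List (List ℕ)} {y : ℕ}
    (h : y ∈ (l.foldl insertEntry R).flatten) : y ∈ l ∨ y ∈ R.flatten := by
  induction l generalizing R with
  | nil => exact Or.inr h
  | cons x l ih =>
    rcases ih h with h | h
    · simp [h]
    · rcases mem_of_mem_insertEntry h with h | h <;> simp [h]

/-- Inserted and bumped entries are always at least `a`, so they pass over the entries of `R` in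
every row. -/
lemma insertEntry_appendRows {R S : List (List ℕ)} {a x : ℕ} (hR : ∀ y ∈ R.flatten, y ≤ a)
    (hS : ∀ y ∈ S.flatten, a ≤ y) (hx : a ≤ x) :
    insertEntry (appendRows R S) x = appendRows R (insertEntry S x) := by
  induction R generalizing S x with
  | nil => rfl
  | cons r R ih =>
    simp only [List.flatten_cons, List.mem_append] at hR
    have hr : ∀ y ∈ r, y ≤ x := fun y hy => (hR y (Or.inl hy)).trans hx
    cases S with
    | nil =>
      have := rowInsert_append (x := x) [] hr
      rw [List.append_nil] at this
      simp [appendRows, insertEntry_cons, this, rowInsert, insertEntry, appendRows_nil]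
    | cons s S =>
      simp only [List.flatten_cons, List.mem_append] at hS
      simp only [appendRows, insertEntry_cons, rowInsert_append s hr]
      rcases hy : (rowInsert x s).2 with _ | y
      · rfl
      · simp only
        rw [ih (fun z hz => hR z (Or.inr hz)) (fun z hz => hS z (Or.inr hz))
          (hS y (Or.inl (mem_of_rowInsert_snd hy)))]

lemma foldl_insertEntry_appendRows {R S : List (List ℕ)} {l : List ℕ} {a : ℕ}
    (hR : ∀ y ∈ R.flatten, y ≤ a) (hS : ∀ y ∈ S.flatten, a ≤ y) (hl : ∀ x ∈ l, a ≤ x) :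
    l.foldl insertEntry (appendRows R S) = appendRows R (l.foldl insertEntry S) := by
  induction l generalizing S with
  | nil => rfl
  | cons x l ih =>
    simp only [List.mem_cons, forall_eq_or_imp] at hl
    rw [List.foldl_cons, List.foldl_cons, insertEntry_appendRows hR hS hl.1, ih ?_ hl.2]
    intro y hy
    rcases mem_of_mem_insertEntry hy with rfl | hy
    · exact hl.1
    · exact hS y hy

/-- The insertion tableau of a direct sum is the concatenation of the insertion tableaux. -/
lemma foldl_insertEntry_append_map {l₁ l₂ : List ℕ} {a : ℕ} (h : ∀ x ∈ l₁, x ≤ a) :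
    (l₁ ++ l₂.map (· + a)).foldl insertEntry [] =
      concat a (l₁.foldl insertEntry []) (l₂.foldl insertEntry []) := by
  have := foldl_insertEntry_appendRows (R := l₁.foldl insertEntry []) (S := [])
    (l := l₂.map (· + a)) (a := a) (fun y hy => ?_) (by simp) (by simp)
  · rw [appendRows_nil] at this
    rw [List.foldl_append, this, concat, ← foldl_insertEntry_map]
    rfl
  · rcases mem_of_mem_foldl_insertEntry hy with hy | hy
    · exact h y hy
    · simp at hy

/-- Whatever leaves `R` at the bottom is smaller than `N` and bumps it into a new row of its own. -/
lemma insertEntry_append_singleton {R : List (List ℕ)} {N x : ℕ} (hR : ∀ y ∈ R.flatten, y < N)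
    (hx : x < N) : insertEntry (R ++ [[N]]) x = insertEntry R x ++ [[N]] := by
  induction R generalizing x with
  | nil => simp [insertEntry, rowInsert, hx]
  | cons r R ih =>
    simp only [List.flatten_cons, List.mem_append] at hR
    simp only [List.cons_append, insertEntry_cons]
    rcases hy : (rowInsert x r).2 with _ | y
    · rfl
    · simp only
      rw [ih (fun z hz => hR z (Or.inr hz)) (hR y (Or.inl (mem_of_rowInsert_snd hy)))]

lemma foldl_insertEntry_append_singleton {R : List (List ℕ)} {l : List ℕ} {N : ℕ}
    (hR : ∀ y ∈ R.flatten, y < N) (hl : ∀ x ∈ l, x < N) :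
    l.foldl insertEntry (R ++ [[N]]) = l.foldl insertEntry R ++ [[N]] := by
  induction l generalizing R with
  | nil => rfl
  | cons x l ih =>
    simp only [List.mem_cons, forall_eq_or_imp] at hl
    rw [List.foldl_cons, List.foldl_cons, insertEntry_append_singleton hR hl.1, ih ?_ hl.2]
    intro y hy
    rcases mem_of_mem_insertEntry hy with rfl | hy
    · exact hl.1
    · exact hR y hy

/-! ### Pushing down the first column -/

/-- Put `x` on top of the first column, moving this column down. -/
def pushCol : ℕ → List (List ℕ) → List (List ℕ)
  | x, [] => [[x]]
  | x, [] :: R => [x] :: R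
  | x, (y :: r) :: R => (x :: r) :: pushCol y R

/-- The first column is increasing, with entries greater than `x`. -/
def FirstColIncreasing : ℕ → List (List ℕ) → Prop
  | _, [] => True
  | _, [] :: _ => False
  | x, (y :: _) :: R => x < y ∧ FirstColIncreasing y R

lemma insertEntry_eq_pushCol {x : ℕ} {R : List (List ℕ)} (h : FirstColIncreasing x R) :
    insertEntry R x = pushCol x R := by
  induction R generalizing x with
  | nil => rfl
  | cons r R ih =>
    cases r with
    | nil => exact h.elim
    | cons y r => simp [insertEntry_cons, rowInsert, h.1, pushCol, ih h.2]

lemma FirstColIncreasing.ne_nil {x : ℕ} {R : List (List ℕ)} (h : FirstColIncreasing x R) :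
    ∀ r ∈ R, r ≠ [] := by
  induction R generalizing x with
  | nil => simp
  | cons r R ih =>
    cases r with
    | nil => exact h.elim
    | cons y r =>
      simp only [List.mem_cons, forall_eq_or_imp]
      exact ⟨by simp, ih h.2⟩

lemma FirstColIncreasing.addAt {x c z : ℕ} {R : List (List ℕ)} (h : FirstColIncreasing x R)
    (hc : c ≤ R.length) (hx : x < z) (hz : ∀ y ∈ R.flatten, y < z) :
    FirstColIncreasing x (addAt c z R) := by
  induction c generalizing x R with
  | zero =>
    cases R with
    | nil => simpa [RichardsonTableau.addAt, FirstColIncreasing]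
    | cons r R =>
      cases r with
      | nil => exact h.elim
      | cons y r => exact h
  | succ c ih =>
    cases R with
    | nil => simp at hc
    | cons r R =>
      cases r with
      | nil => exact h.elim
      | cons y r =>
        simp only [List.flatten_cons, List.mem_append] at hz
        exact ⟨h.1, ih h.2 (by simpa using hc) (hz y (by simp)) fun w hw => hz w (Or.inr hw)⟩

/-- The entry `z` moves down only if it opens a new row and so belongs to the first column. This is
the case distinction in `arcBody`. -/
lemma pushCol_addAt {c x z : ℕ} {R : List (List ℕ)} (hR : ∀ r ∈ R, r ≠ []) (hc : c ≤ R.length) :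
    pushCol x (addAt c z R) = addAt (if c = R.length then c + 1 else c) z (pushCol x R) := by
  induction c generalizing x R with
  | zero =>
    cases R with
    | nil => simp [addAt, pushCol]
    | cons r R =>
      cases r with
      | nil => simp at hR
      | cons y r => simp [addAt, pushCol]
  | succ c ih =>
    cases R with
    | nil => simp at hc
    | cons r R =>
      cases r with
      | nil => simp at hR
      | cons y r =>
        simp only [List.mem_cons, forall_eq_or_imp] at hR
        simp only [List.length_cons, Nat.add_le_add_iff_right] at hc
        simp only [addAt, pushCol, ih hR.2 hc, List.length_cons, Nat.add_right_cancel_iff]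
        split_ifs <;> rfl

lemma addAt_length (x : ℕ) (R : List (List ℕ)) : addAt R.length x R = R ++ [[x]] := by
  induction R with
  | nil => rfl
  | cons r R ih => simp [addAt, ih]

/-- The tableau of a word with all entries increased by one. -/
def shiftTab (s : List ℕ) : List (List ℕ) := (tab s).map fun r => r.map (· + 1)

lemma mem_flatten_shiftTab {s : List ℕ} {y : ℕ} (h : y ∈ (shiftTab s).flatten) :
    2 ≤ y ∧ y ≤ s.length + 1 := by
  rw [shiftTab, mem_flatten_iff_mem_row] at h
  obtain ⟨i, hi⟩ := h
  rw [row_map_map, List.mem_map] at hi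
  obtain ⟨x, hx, rfl⟩ := hi
  have := (mem_row_tab.1 hx).pos_le
  omega

lemma length_shiftTab {s : List ℕ} (hs : IsRestricted s) : (shiftTab s).length = height s := by
  rw [shiftTab, List.length_map, length_tab hs]

lemma shiftTab_cons (c : ℕ) (s : List ℕ) :
    shiftTab (c :: s) = addAt c (s.length + 2) (shiftTab s) := by
  rw [shiftTab, tab, map_addAt]; rfl

lemma firstColIncreasing_shiftTab {s : List ℕ} (hs : IsRestricted s) :
    FirstColIncreasing 1 (shiftTab s) := by
  induction s with
  | nil => simp [shiftTab, tab, FirstColIncreasing]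
  | cons c s ih =>
    rw [shiftTab_cons]
    refine (ih hs.2).addAt (by rw [length_shiftTab hs.2]; exact hs.1) (by omega) fun y hy => ?_
    have := mem_flatten_shiftTab hy
    omega

lemma pushCol_shiftTab {s : List ℕ} (hs : IsRestricted s) :
    pushCol 1 (shiftTab s) = tab (arcBody s) := by
  induction s with
  | nil => rfl
  | cons c s ih =>
    have hc : c ≤ (shiftTab s).length := by rw [length_shiftTab hs.2]; exact hs.1
    rw [shiftTab_cons, pushCol_addAt (firstColIncreasing_shiftTab hs.2).ne_nil hc,
      length_shiftTab hs.2, ih hs.2, arcBody, tab, length_arcBody]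

/-- The insertion tableau of an involution surrounded by an arc. -/
lemma foldl_insertEntry_arc {s l : List ℕ} (hs : IsRestricted s)
    (h : l.foldl insertEntry [] = tab s) (hl : ∀ x ∈ l, x ≤ s.length) :
    ((s.length + 2) :: (l.map (· + 1) ++ [1])).foldl insertEntry [] = tab (arcWord s) := by
  have h1 : (l.map (· + 1)).foldl insertEntry [] = shiftTab s := by
    rw [shiftTab, ← h, ← foldl_insertEntry_map]; rfl
  have h2 := foldl_insertEntry_append_singleton (R := []) (l := l.map (· + 1))
    (N := s.length + 2) (by simp) (fun x hx => by
      obtain ⟨y, hy, rfl⟩ := List.mem_map.1 hx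
      have := hl y hy
      omega)
  have hinc := firstColIncreasing_shiftTab hs
  -- The separate bottom row is treated as `s.length + 2` added in row `height s`; pushing moves it
  -- to row `height s + 1`, the last letter of `arcWord s`.
  rw [List.foldl_cons, List.foldl_append, show insertEntry [] (s.length + 2) = [] ++ [[s.length + 2]]
    from rfl, h2, h1, List.foldl_cons, List.foldl_nil, ← addAt_length, insertEntry_eq_pushCol,
    pushCol_addAt hinc.ne_nil le_rfl, if_pos rfl, pushCol_shiftTab hs, length_shiftTab hs, arcWord,
    tab, length_arcBody]
  refine hinc.addAt le_rfl (by omega) fun y hy => ?_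
  have := mem_flatten_shiftTab hy
  omega

/-! ### The permutation of a tree -/

/-- `w` restricts to a noncrossing involution of the interval `[a, b)`. -/
def IsNCOn (w : ℕ → ℕ) (a b : ℕ) : Prop :=
  (∀ i, a ≤ i → i < b → a ≤ w i ∧ w i < b ∧ w (w i) = i) ∧
    ∀ i k, a ≤ i → i < k → k < w i → w i < w k → w k < b → False

namespace NCTree

/-- The involution of `{0, …, m.size - 1}` encoded by `m`. -/
def fn : NCTree → ℕ → ℕ
  | nil, i => i
  | fix p, i => if i < p.size then p.fn i else i
  | arc p s, i =>
    if i < p.size then p.fn i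
    else if i = p.size then p.size + s.size + 1
    else if i < p.size + s.size + 1 then s.fn (i - (p.size + 1)) + (p.size + 1)
    else p.size

variable {p s : NCTree} {i : ℕ}

lemma fn_fix_of_lt (h : i < p.size) : (fix p).fn i = p.fn i := by simp [fn, h]

lemma fn_fix_size : (fix p).fn p.size = p.size := by simp [fn]

lemma fn_arc_of_lt (h : i < p.size) : (arc p s).fn i = p.fn i := by simp [fn, h]

lemma fn_arc_size : (arc p s).fn p.size = p.size + s.size + 1 := by simp [fn]

lemma fn_arc_add (h : i < s.size) :
    (arc p s).fn (i + (p.size + 1)) = s.fn i + (p.size + 1) := by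
  rw [fn, if_neg (by omega), if_neg (by omega), if_pos (by omega), Nat.add_sub_cancel]

lemma fn_arc_last : (arc p s).fn (p.size + s.size + 1) = p.size := by
  rw [fn, if_neg (by omega), if_neg (by omega), if_neg (by omega)]

lemma lt_size_fix (h : i < (fix p).size) : i < p.size ∨ i = p.size := by
  simp only [size] at h; omega

lemma lt_size_arc (h : i < (arc p s).size) : i < p.size ∨ i = p.size ∨
    (∃ j < s.size, i = j + (p.size + 1)) ∨ i = p.size + s.size + 1 := by
  simp only [size] at h
  by_cases h1 : i ≤ p.size
  · omega
  · by_cases h2 : i = p.size + s.size + 1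
    · omega
    · exact Or.inr (Or.inr (Or.inl ⟨i - (p.size + 1), by omega, by omega⟩))

lemma fn_lt (m : NCTree) (h : i < m.size) : m.fn i < m.size := by
  induction m generalizing i with
  | nil => exact h
  | fix p ih =>
    rcases lt_size_fix h with h | rfl
    · rw [fn_fix_of_lt h, size]; exact (ih h).trans (Nat.lt_succ_self _)
    · rwa [fn_fix_size]
  | arc p s ihp ihs =>
    rcases lt_size_arc h with h | rfl | ⟨j, hj, rfl⟩ | rfl
    · rw [fn_arc_of_lt h, size]; have := ihp h; omega
    · rw [fn_arc_size, size]; omega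
    · rw [fn_arc_add hj, size]; have := ihs hj; omega
    · rw [fn_arc_last, size]; omega

lemma fn_fn (m : NCTree) (h : i < m.size) : m.fn (m.fn i) = i := by
  induction m generalizing i with
  | nil => rfl
  | fix p ih =>
    rcases lt_size_fix h with h | rfl
    · rw [fn_fix_of_lt h, fn_fix_of_lt (p.fn_lt h), ih h]
    · rw [fn_fix_size, fn_fix_size]
  | arc p s ihp ihs =>
    rcases lt_size_arc h with h | rfl | ⟨j, hj, rfl⟩ | rfl
    · rw [fn_arc_of_lt h, fn_arc_of_lt (p.fn_lt h), ihp h]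
    · rw [fn_arc_size, fn_arc_last]
    · rw [fn_arc_add hj, fn_arc_add (s.fn_lt hj), ihs hj]
    · rw [fn_arc_last, fn_arc_size]

lemma not_crossing (m : NCTree) {k : ℕ} (hi : i < k) (hk : k < m.fn i) (hik : m.fn i < m.fn k)
    (hlt : k < m.size) : False := by
  induction m generalizing i k with
  | nil => simp [size] at hlt
  | fix p ih =>
    rcases lt_size_fix (hi.trans hlt) with h | rfl
    · have := p.fn_lt h
      rw [fn_fix_of_lt h] at hk hik
      rw [fn_fix_of_lt (by omega)] at hik
      exact ih hi hk hik (by omega)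
    · rw [fn_fix_size] at hk; omega
  | arc p s ihp ihs =>
    rcases lt_size_arc (hi.trans hlt) with h | rfl | ⟨j, h, rfl⟩ | rfl
    · have := p.fn_lt h
      rw [fn_arc_of_lt h] at hk hik
      rw [fn_arc_of_lt (by omega)] at hik
      exact ihp hi hk hik (by omega)
    · have := fn_lt _ hlt
      rw [fn_arc_size] at hik
      simp only [size] at this
      omega
    · have := s.fn_lt h
      rw [fn_arc_add h] at hk hik
      obtain ⟨l, rfl⟩ : ∃ l, k = l + (p.size + 1) := ⟨k - (p.size + 1), by omega⟩
      rw [fn_arc_add (by omega)] at hik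
      exact ihs (i := j) (k := l) (by omega) (by omega) (by omega) (by omega)
    · rw [fn_arc_last] at hk; omega

lemma isNCOn_fn (m : NCTree) : IsNCOn m.fn 0 m.size :=
  ⟨fun _ _ hi => ⟨Nat.zero_le _, m.fn_lt hi, m.fn_fn hi⟩,
    fun i _ _ hik hk hlt hm => m.not_crossing hik hk hlt (by omega)⟩

/-- The one-line notation of the involution encoded by `m`. -/
def permWord (m : NCTree) : List ℕ := (List.range m.size).map fun i => m.fn i + 1

lemma le_size_of_mem_permWord {m : NCTree} {x : ℕ} (hx : x ∈ m.permWord) : x ≤ m.size := by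
  simp only [permWord, List.mem_map, List.mem_range] at hx
  obtain ⟨i, hi, rfl⟩ := hx
  exact m.fn_lt hi

lemma permWord_fix (p : NCTree) : (fix p).permWord = p.permWord ++ [1].map (· + p.size) := by
  simp only [permWord, size, List.range_succ, List.map_append, List.map_cons, List.map_nil,
    fn_fix_size, add_comm 1]
  congr 1
  exact List.map_congr_left fun i hi => by rw [fn_fix_of_lt (List.mem_range.1 hi)]

lemma permWord_arc (p s : NCTree) : (arc p s).permWord =
    p.permWord ++ ((s.size + 2) :: (s.permWord.map (· + 1) ++ [1])).map (· + p.size) := by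
  rw [permWord, size, List.range_add, List.map_append]
  congr 1
  · exact List.map_congr_left fun i hi => by rw [fn_arc_of_lt (List.mem_range.1 hi)]
  · rw [List.range_succ_eq_map, List.range_succ]
    simp only [permWord, List.map_cons, List.map_append, List.map_map, List.map_nil]
    congr 1
    · have := fn_arc_size (p := p) (s := s)
      simp only [add_zero, this]; omega
    congr 1
    · refine List.map_congr_left fun i hi => ?_
      have := fn_arc_add (p := p) (List.mem_range.1 hi)
      simp only [Function.comp, show p.size + i.succ = i + (p.size + 1) by omega, this]
      omega
    · have := fn_arc_last (p := p) (s := s)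
      simp only [show p.size + s.size.succ = p.size + s.size + 1 by omega, this]
      rw [add_comm 1]

lemma foldl_insertEntry_permWord (m : NCTree) :
    m.permWord.foldl insertEntry [] = tab m.rowWord := by
  induction m with
  | nil => rfl
  | fix p ih =>
    rw [permWord_fix, foldl_insertEntry_append_map fun x hx => le_size_of_mem_permWord hx, ih,
      show (fix p).rowWord = [0] ++ p.rowWord from rfl, tab_append, length_rowWord]
    rfl
  | arc p s ihp ihs =>
    have := foldl_insertEntry_arc s.isRich_rowWord.isRestricted ihs
      (fun x hx => by rw [length_rowWord]; exact le_size_of_mem_permWord hx)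
    rw [length_rowWord] at this
    rw [permWord_arc, foldl_insertEntry_append_map fun x hx => le_size_of_mem_permWord hx, ihp,
      this, rowWord, tab_append, length_rowWord]

lemma rowWord_eq_nil {m : NCTree} (h : m.size = 0) : m.rowWord = [] := by
  rw [← List.length_eq_zero_iff, length_rowWord, h]

/-- If the left part `p` were nonempty, the image of `0` would remain in it; so the tree is a single
fixed point or a single outer arc. -/
lemma isPrimeTableau_tab_rowWord {m : NCTree} (h : m.fn 0 + 1 = m.size) :
    IsPrimeTableau (tab m.rowWord) := by
  cases m with
  | nil => simp [size] at h
  | fix p =>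
    rcases Nat.eq_zero_or_pos p.size with h0 | h0
    · rw [rowWord, rowWord_eq_nil h0]
      exact isPrimeTableau_tab_singleton
    · have := p.fn_lt h0
      rw [fn_fix_of_lt h0, size] at h
      omega
  | arc p s =>
    rcases Nat.eq_zero_or_pos p.size with h0 | h0
    · rw [rowWord, rowWord_eq_nil h0, List.append_nil]
      exact isPrimeTableau_tab_arcWord s.isRich_rowWord.isRestricted
    · have := p.fn_lt h0
      rw [fn_arc_of_lt h0, size] at h
      omega

end NCTree

/-! ### The tree of a noncrossing involution -/

namespace IsNCOn

variable {w : ℕ → ℕ} {a b : ℕ}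

lemma sub (h : IsNCOn w a b) {c d : ℕ} (hc : a ≤ c) (hd : d ≤ b)
    (hw : ∀ i, c ≤ i → i < d → c ≤ w i ∧ w i < d) : IsNCOn w c d :=
  ⟨fun i hi hi' => ⟨(hw i hi hi').1, (hw i hi hi').2, (h.1 i (by omega) (by omega)).2.2⟩,
    fun i k hi hik hk hlt hb => h.2 i k (by omega) hik hk hlt (by omega)⟩

/-- An arc leaving the region under `(i, w i)` would cross it on the right or on the left, and its
ends are already matched to each other. -/
lemma inner (h : IsNCOn w a b) {i : ℕ} (hi : a ≤ i) (hlt : i < w i) (hb : w i < b) :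
    IsNCOn w (i + 1) (w i) := by
  refine h.sub (by omega) hb.le fun k hk hk' => ?_
  obtain ⟨h1, h2, h3⟩ := h.1 k (by omega) (by omega)
  have hwi := (h.1 i hi (by omega)).2.2
  have hne : w k ≠ i := fun h' => by rw [h'] at h3; omega
  have hne' : w k ≠ w i := fun h' => by rw [h', hwi] at h3; omega
  have hA : ¬ w i < w k := fun h' => h.2 i k hi hk hk' h' h2
  have hB : ¬ w k < i := fun h' => h.2 (w k) i h1 h' (by omega) (by omega) hb
  omega

lemma left (h : IsNCOn w a b) {i : ℕ} (hi : a ≤ i) (hlt : i < w i) (hb : w i + 1 = b) :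
    IsNCOn w a i := by
  refine h.sub le_rfl (by omega) fun k hk hk' => ?_
  obtain ⟨h1, h2, h3⟩ := h.1 k (by omega) (by omega)
  have hwi := (h.1 i hi (by omega)).2.2
  have hne : w k ≠ i := fun h' => by rw [h'] at h3; omega
  have hne' : w k ≠ w i := fun h' => by rw [h', hwi] at h3; omega
  have hA : ¬ i < w k := fun h' => h.2 k i hk hk' h' (by omega) (by omega)
  omega

lemma exists_tree (h : IsNCOn w a b) :
    ∃ m : NCTree, m.size = b - a ∧ ∀ i < m.size, w (i + a) = m.fn i + a := by
  induction hn : b - a using Nat.strong_induction_on generalizing a b with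
  | _ n ih =>
    subst hn
    rcases Nat.eq_zero_or_pos (b - a) with h0 | h0
    · exact ⟨.nil, h0.symm, fun i hi => by simp [NCTree.size] at hi⟩
    obtain ⟨h1, h2, h3⟩ := h.1 (b - 1) (by omega) (by omega)
    rcases (show w (b - 1) = b - 1 ∨ w (b - 1) < b - 1 by omega) with h4 | h4
    · have hp : IsNCOn w a (b - 1) := by
        refine h.sub le_rfl (by omega) fun k hk hk' => ?_
        obtain ⟨h5, h6, h7⟩ := h.1 k (by omega) (by omega)
        have : w k ≠ b - 1 := fun h' => by rw [h'] at h7; omega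
        omega
      obtain ⟨p, hps, hp⟩ := ih _ (by omega) hp rfl
      refine ⟨.fix p, by simp only [NCTree.size]; omega, fun i hi => ?_⟩
      rcases NCTree.lt_size_fix hi with hi | rfl
      · rw [NCTree.fn_fix_of_lt hi, hp i hi]
      · rw [NCTree.fn_fix_size, hps, show b - 1 - a + a = b - 1 by omega, h4]
    · have hp := h.left h1 (by omega) (by omega)
      have hs := h.inner h1 (by omega) (by omega)
      rw [h3] at hs
      set j := w (b - 1) with hj
      obtain ⟨p, hps, hp⟩ := ih _ (by omega) hp rfl
      obtain ⟨s, hss, hs⟩ := ih _ (by omega) hs rfl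
      refine ⟨.arc p s, by simp only [NCTree.size]; omega, fun i hi => ?_⟩
      rcases NCTree.lt_size_arc hi with hi | rfl | ⟨k, hk, rfl⟩ | rfl
      · rw [NCTree.fn_arc_of_lt hi, hp i hi]
      · rw [NCTree.fn_arc_size, show p.size + a = j by omega, h3]; omega
      · rw [NCTree.fn_arc_add hk, show k + (p.size + 1) + a = k + (j + 1) by omega, hs k hk]; omega
      · rw [NCTree.fn_arc_last, show p.size + s.size + 1 + a = b - 1 by omega]; omega

end IsNCOn

/-! ### Permutations of `Fin n` as functions on the natural numbers -/

/-- Extension of a permutation by fixed points. -/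
def extend {n : ℕ} (w : Equiv.Perm (Fin n)) (i : ℕ) : ℕ := if h : i < n then w ⟨i, h⟩ else i

lemma extend_val {n : ℕ} (w : Equiv.Perm (Fin n)) (i : Fin n) : extend w i = w i := by
  simp [extend]

lemma word_eq {n : ℕ} (w : Equiv.Perm (Fin n)) :
    word w = (List.range n).map fun i => extend w i + 1 :=
  List.ext_getElem (by simp [word]) fun i h1 h2 => by
    simp only [word, List.length_ofFn] at h1
    simp [word, extend, h1]

lemma word_injective {n : ℕ} : Function.Injective (word (n := n)) := fun w w' h => by
  ext i
  have := congrFun (List.ofFn_injective h) i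
  omega

lemma length_word {n : ℕ} (w : Equiv.Perm (Fin n)) : (word w).length = n := by simp [word]

lemma le_of_mem_word {n : ℕ} {w : Equiv.Perm (Fin n)} {x : ℕ} (hx : x ∈ word w) : x ≤ n := by
  simp only [word, List.mem_ofFn] at hx
  obtain ⟨i, rfl⟩ := hx
  exact (w i).2

lemma isNCOn_extend {n : ℕ} {w : Equiv.Perm (Fin n)} (hw : w ∈ NC n) : IsNCOn (extend w) 0 n := by
  constructor
  · intro i _ hi
    have h1 := extend_val w ⟨i, hi⟩
    simp only at h1
    rw [h1]
    exact ⟨Nat.zero_le _, (w _).2, by rw [extend_val, hw.1]⟩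
  · intro i k _ hik hk hlt hn
    have hkn : k < n := by
      by_contra h
      have : extend w k = k := by simp [extend, h]
      omega
    have hin : i < n := by omega
    have h1 := extend_val w ⟨i, hin⟩
    have h2 := extend_val w ⟨k, hkn⟩
    simp only at h1 h2
    exact hw.2 ⟨⟨i, hin⟩, ⟨k, hkn⟩, _, _, rfl, rfl, hik,
      show k < (w ⟨i, hin⟩ : ℕ) by omega, show (w ⟨i, hin⟩ : ℕ) < w ⟨k, hkn⟩ by omega⟩

lemma IsNCOn.exists_perm {w : ℕ → ℕ} {a b : ℕ} (h : IsNCOn w a b) :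
    ∃ u ∈ NC (b - a), word u = (List.range (b - a)).map fun i => w (i + a) - a + 1 := by
  have hlt : ∀ i : Fin (b - a), w (i + a) - a < b - a := fun i => by
    have := h.1 (i + a) (by omega) (by omega); omega
  have hinv : Function.Involutive fun i : Fin (b - a) => (⟨w (i + a) - a, hlt i⟩ : Fin (b - a)) := by
    intro i
    have := h.1 (i + a) (by omega) (by omega)
    ext
    simp only
    rw [Nat.sub_add_cancel this.1, this.2.2, Nat.add_sub_cancel]
  refine ⟨hinv.toPerm, ⟨hinv, ?_⟩, ?_⟩
  · rintro ⟨i, k, _, _, rfl, rfl, hik, hk, hlt⟩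
    have h1 := h.1 (i + a) (by omega) (by omega)
    have h2 := h.1 (k + a) (by omega) (by omega)
    simp only [Function.Involutive.coe_toPerm, Fin.lt_def] at hik hk hlt
    exact h.2 (i + a) (k + a) (by omega) (by omega) (by omega) (by omega) (by omega)
  · exact List.ext_getElem (by simp [word]) fun i h1 h2 => by simp [word]

lemma exists_tree_of_mem_NC {n : ℕ} {w : Equiv.Perm (Fin n)} (hw : w ∈ NC n) :
    ∃ m : NCTree, m.size = n ∧ word w = m.permWord ∧ ∀ i < n, extend w i = m.fn i := by
  obtain ⟨m, rfl, hm⟩ := (isNCOn_extend hw).exists_tree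
  refine ⟨m, rfl, ?_, hm⟩
  rw [word_eq]
  exact List.map_congr_left fun i hi => by rw [← add_zero (m.fn i), ← hm i (List.mem_range.1 hi), add_zero]

lemma exists_mem_NC (m : NCTree) : ∃ w ∈ NC m.size, word w = m.permWord :=
  m.isNCOn_fn.exists_perm

lemma Φ_eq_tab {n : ℕ} {w : Equiv.Perm (Fin n)} {m : NCTree} (h : word w = m.permWord) :
    Φ w = tab m.rowWord := by
  rw [Φ, h, m.foldl_insertEntry_permWord]

/-- Every step of the chain involution, tree, rich word, tableau can be reversed. -/
theorem bijOn_Φ (n : ℕ) : Set.BijOn (Φ (n := n)) (NC n) (RT n) := by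
  refine ⟨fun w hw => ?_, fun w hw w' hw' h => ?_, fun R hR => ?_⟩
  · obtain ⟨m, rfl, hm, -⟩ := exists_tree_of_mem_NC hw
    exact mem_RT_iff.2 ⟨_, m.isRich_rowWord, m.length_rowWord, (Φ_eq_tab hm).symm⟩
  · obtain ⟨m, -, hm, -⟩ := exists_tree_of_mem_NC hw
    obtain ⟨m', -, hm', -⟩ := exists_tree_of_mem_NC hw'
    rw [Φ_eq_tab hm, Φ_eq_tab hm'] at h
    obtain rfl := NCTree.rowWord_injective (tab_injective h)
    exact word_injective (hm.trans hm'.symm)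
  · obtain ⟨f, hf, rfl, rfl⟩ := mem_RT_iff.1 hR
    obtain ⟨m, rfl⟩ := NCTree.exists_rowWord_eq hf
    obtain ⟨w, hw, hm⟩ := exists_mem_NC m
    rw [m.length_rowWord]
    exact ⟨w, hw, Φ_eq_tab hm⟩

/-! ### Direct sums and primes -/

lemma exists_isDirectSum {n : ℕ} (hn : 0 < n) {w : Equiv.Perm (Fin n)} (hw : w ∈ NC n)
    (h0 : extend w 0 + 1 ≠ n) : ∃ (a b : ℕ) (u : Equiv.Perm (Fin a)) (v : Equiv.Perm (Fin b)),
      a + b = n ∧ 0 < a ∧ 0 < b ∧ u ∈ NC a ∧ v ∈ NC b ∧ IsDirectSum w u v := by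
  have h := isNCOn_extend hw
  obtain ⟨-, h1, h2⟩ := h.1 0 le_rfl hn
  set j := extend w 0 with hj
  -- The cut is made just after the partner `j` of the first point: points under this arc stay under
  -- it, and the involution then preserves the complement too.
  have hu : IsNCOn (extend w) 0 (j + 1) := by
    refine h.sub le_rfl (by omega) fun i _ hi => ⟨Nat.zero_le _, ?_⟩
    rcases (show i = 0 ∨ i = j ∨ (0 < i ∧ i < j) by omega) with rfl | rfl | hi
    · omega
    · omega
    · have := (h.inner le_rfl (by omega) (by omega)).1 i (by omega) (by omega)
      omega
  have hv : IsNCOn (extend w) (j + 1) n := by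
    refine h.sub (by omega) le_rfl fun i hi hi' => ?_
    obtain ⟨-, h3, h4⟩ := h.1 i (by omega) (by omega)
    refine ⟨?_, h3⟩
    by_contra hlt
    have := (hu.1 (extend w i) (by omega) (by omega)).2.1
    omega
  obtain ⟨u, hu', hwu⟩ := hu.exists_perm
  obtain ⟨v, hv', hwv⟩ := hv.exists_perm
  refine ⟨j + 1 - 0, n - (j + 1), u, v, by omega, by omega, by omega, hu', hv', ?_⟩
  rw [IsDirectSum, hwu, hwv, word_eq, List.map_map]
  rw [show List.range n = List.range ((j + 1 - 0) + (n - (j + 1))) by congr 1; omega,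
    List.range_add, List.map_append, List.map_map]
  congr 1
  refine List.map_congr_left fun i hi => ?_
  have := List.mem_range.1 hi
  have := (hv.1 (i + (j + 1)) (by omega) (by omega)).1
  simp only [Function.comp, Nat.sub_zero, add_comm (j + 1) i]
  omega

lemma isPrimePerm_iff {n : ℕ} (hn : 0 < n) {w : Equiv.Perm (Fin n)} (hw : w ∈ NC n) :
    IsPrimePerm w ↔ extend w 0 + 1 = n := by
  constructor
  · intro h
    by_contra h0
    obtain ⟨a, b, u, v, -, ha, hb, -, -, h'⟩ := exists_isDirectSum hn hw h0
    exact h ⟨a, b, u, v, ha, hb, h'⟩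
  · rintro h ⟨a, b, u, v, ha, hb, huv⟩
    have hlen := congrArg List.length huv
    simp only [List.length_append, List.length_map, length_word] at hlen
    have h0 : (word w)[0]'(by rwa [length_word]) = (word u)[0]'(by rwa [length_word]) := by
      simp only [IsDirectSum] at huv
      simp only [huv]
      exact List.getElem_append_left (by rwa [length_word])
    have h1 : (word w)[0]'(by rwa [length_word]) = extend w 0 + 1 := by simp [word_eq]
    -- The first letter of a direct sum belongs to `u`, so it is at most `a < n`.
    have h2 := le_of_mem_word (List.getElem_mem (l := word u) (n := 0) (by rwa [length_word]))
    omega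

theorem image_primeNC {n : ℕ} (hn : 0 < n) : Φ '' PrimeNC n = PrimeRT n := by
  ext R
  constructor
  · rintro ⟨w, ⟨hw, hp⟩, rfl⟩
    refine ⟨(bijOn_Φ n).1 hw, ?_⟩
    rw [isPrimePerm_iff hn hw] at hp
    obtain ⟨m, hmn, hm, hfn⟩ := exists_tree_of_mem_NC hw
    rw [hfn 0 hn, ← hmn] at hp
    rw [Φ_eq_tab hm]
    exact NCTree.isPrimeTableau_tab_rowWord hp
  · rintro ⟨hR, hp⟩
    obtain ⟨w, hw, rfl⟩ := (bijOn_Φ n).surjOn hR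
    refine ⟨w, ⟨hw, ?_⟩, rfl⟩
    rw [isPrimePerm_iff hn hw]
    by_contra h0
    obtain ⟨a, b, u, v, -, ha, hb, hu, hv, huv⟩ := exists_isDirectSum hn hw h0
    refine hp ⟨a, b, Φ u, Φ v, ha, hb, ((bijOn_Φ a).1 hu).1, ((bijOn_Φ b).1 hv).1, ?_⟩
    rw [Φ, huv, foldl_insertEntry_append_map fun x hx => le_of_mem_word hx]
    rfl

end RichardsonTableau

theorem mainTheorem5 (n : ℕ) (hn : 1 ≤ n) :
    Set.BijOn (RichardsonTableau.Φ (n := n)) (RichardsonTableau.NC n) (RichardsonTableau.RT n) ∧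
    (∀ w ∈ RichardsonTableau.NC n,
      RichardsonTableau.IsPrimePerm w ↔ ((w ⟨0, hn⟩ : Fin n) : ℕ) + 1 = n) ∧
    RichardsonTableau.Φ '' RichardsonTableau.PrimeNC n = RichardsonTableau.PrimeRT n := by
  refine ⟨RichardsonTableau.bijOn_Φ n, fun w hw => ?_, RichardsonTableau.image_primeNC hn⟩
  rw [RichardsonTableau.isPrimePerm_iff hn hw, ← RichardsonTableau.extend_val]
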